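/- Let $G$ be a finite group and let $O\subset G\setminus\{1\}$ be a subset invariant under conjugation, $O=C_1\sqcup\dots\sqcup C_m$ its decomposition into conjugacy classes of $G$ (the pair $(G,O)$ is an equipped finite group). Let $S(G,O)$ be the factorization semigroup, that is, the semigroup (with unit) generated by letters $x_g$, $g\in O$, subject to the relations $$x_{g_1}\cdot x_{g_2}=x_{g_2}\cdot x_{g_2^{-1}g_1g_2}=x_{g_1g_2g_1^{-1}}\cdot x_{g_1},\qquad g_1,g_2\in O.$$ Let $\alpha_G:S(G,O)\to G$ be the homomorphism with $\alpha_G(x_g)=g$. For $s=x_{g_1}\cdots x_{g_n}\in S(G,O)$ let $\tau(s)=(\tau_1(s),\dots,\tau_m(s))$, where $\tau_i(s)$ is the number of factors $x_{g_j}$ with $g_j\in C_i$ (the type of $s$), and let $G_s$ be the subgroup of $G$ generated by $g_1,\dots,g_n$; both are independent of the chosen word. Put $S(G,O)^G=\{s\in S(G,O)\mid G_s=G\}$. Let $G_\Gamma$ be the group generated by elements $y_g$, $g\in O$, subject to the relations $y_{g}^{-1}y_{g_1}y_{g}=y_{g_2}$ for all $g,g_1,g_2\in O$ with $g^{-1}g_1g=g_2$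 in $G$, let $\beta:G_\Gamma\to G$ be the homomorphism with $\beta(y_g)=g$, and let $$a=a_{(G,O)}=\bigl|\ker\beta\cap[G_\Gamma,G_\Gamma]\bigr|$$ be the ambiguity index of $(G,O)$. Theorem. For each equipped finite group $(G,O)$ there is a constant $T=T_{(G,O)}\in\mathbb N$ such that if an element $s_1\in S(G,O)^G$ satisfies $\tau_i(s_1)\ge T$ for all $i=1,\dots,m$, then there are $a$ elements $s_1,\dots,s_a\in S(G,O)^G$ (the first of which is the given one) such that (i) $s_i\ne s_j$ for $1\le i<j\le a$; (ii) $\tau(s_i)=\tau(s_1)$ for $1\le i\le a$; (iii) $\alpha_G(s_i)=\alpha_G(s_1)$ for $1\le i\le a$; (iv) if $s\in S(G,O)^G$ is such that $\tau(s)=\tau(s_1)$ and $\alpha_G(s)=\alpha_G(s_1)$, then $s=s_i$ for some $i$, $1\le i\le a$. -/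

import Mathlib

namespace EquippedGroup

universe u

variable {G : Type u} [Group G]

/-- `(G, O)` is an equipped group: `O` is invariant under inner automorphisms and does not contain
the identity. (That `O` is a union of finitely many conjugacy classes is automatic for finite
`G`.) -/
structure IsEquipped (O : Set G) : Prop where
  conj_mem : ∀ g : G, ∀ x ∈ O, g * x * g⁻¹ ∈ O
  one_notMem : (1 : G) ∉ O

/-! ### The factorization semigroup -/

/-- The defining relations of the factorization semigroup:
`x_a x_b = x_b x_c` with `c = b⁻¹ a b`, and `x_a x_b = x_c x_a` with `c = a b a⁻¹`. -/
inductive FactRel (O : Set G) : FreeMonoid O → FreeMonoid O → Prop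
  | right (a b c : O) (h : (c : G) = (b : G)⁻¹ * a * b) :
      FactRel O (FreeMonoid.of a * FreeMonoid.of b) (FreeMonoid.of b * FreeMonoid.of c)
  | left (a b c : O) (h : (c : G) = (a : G) * b * (a : G)⁻¹) :
      FactRel O (FreeMonoid.of a * FreeMonoid.of b) (FreeMonoid.of c * FreeMonoid.of a)

/-- The factorization semigroup `S(G, O)` (with the empty product as unit). -/
abbrev FactSemigroup (O : Set G) : Type u := PresentedMonoid (FactRel O)

/-- The generator `x_g` of `S(G, O)`. -/
def gen (O : Set G) (g : O) : FactSemigroup O := PresentedMonoid.of (FactRel O) g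

/-- The product homomorphism `α : S(G, O) → G`, `x_g ↦ g`. -/
def prodHom (O : Set G) : FactSemigroup O →* G :=
  PresentedMonoid.lift (fun g : O => (g : G)) (by
    intro a b h
    cases h with
    | right a b c h => simp [h, mul_assoc]
    | left a b c h => simp [h, mul_assoc])

/-- The subgroup of `G` generated by the letters of a word. -/
def wordSubgroup (O : Set G) (w : FreeMonoid O) : Subgroup G :=
  Subgroup.closure {g : G | ∃ x ∈ FreeMonoid.toList w, (x : G) = g}

theorem wordSubgroup_mul (O : Set G) (v w : FreeMonoid O) :
    wordSubgroup O (v * w) = wordSubgroup O v ⊔ wordSubgroup O w := by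
  rw [wordSubgroup, wordSubgroup, wordSubgroup, ← Subgroup.closure_union]
  congr 1
  ext g
  simp only [FreeMonoid.toList_mul, List.mem_append, Set.mem_ofPred_eq, Set.mem_union]
  constructor
  · rintro ⟨x, hx | hx, rfl⟩
    · exact Or.inl ⟨x, hx, rfl⟩
    · exact Or.inr ⟨x, hx, rfl⟩
  · rintro (⟨x, hx, rfl⟩ | ⟨x, hx, rfl⟩)
    · exact ⟨x, Or.inl hx, rfl⟩
    · exact ⟨x, Or.inr hx, rfl⟩

theorem wordSubgroup_of (O : Set G) (a : O) :
    wordSubgroup O (FreeMonoid.of a) = Subgroup.closure {(a : G)} := by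
  rw [wordSubgroup]
  congr 1
  ext g
  simp [eq_comm]

theorem wordSubgroup_eq_of_rel (O : Set G) {v w : FreeMonoid O} (h : conGen (FactRel O) v w) :
    wordSubgroup O v = wordSubgroup O w := by
  let c : Con (FreeMonoid O) :=
    { r := fun v w => wordSubgroup O v = wordSubgroup O w
      iseqv := ⟨fun _ => rfl, fun h => h.symm, fun h k => h.trans k⟩
      mul' := fun h k => by
        rw [wordSubgroup_mul, wordSubgroup_mul, h, k] }
  have hc : conGen (FactRel O) ≤ c := by
    rw [Con.conGen_le]
    intro v w hvw
    change wordSubgroup O v = wordSubgroup O w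
    cases hvw with
    | right a b d h =>
      simp only [wordSubgroup_mul, wordSubgroup_of]
      have ha : (a : G) = b * d * (b : G)⁻¹ := by rw [h]; group
      apply le_antisymm <;> refine sup_le ?_ ?_ <;> rw [Subgroup.closure_le,
        Set.singleton_subset_iff, SetLike.mem_coe]
      · rw [ha]
        have hb : (b : G) ∈ Subgroup.closure {(b : G)} ⊔ Subgroup.closure {(d : G)} :=
          Subgroup.mem_sup_left (Subgroup.mem_closure_singleton_self _)
        have hd : (d : G) ∈ Subgroup.closure {(b : G)} ⊔ Subgroup.closure {(d : G)} :=
          Subgroup.mem_sup_right (Subgroup.mem_closure_singleton_self _)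
        exact mul_mem (mul_mem hb hd) (inv_mem hb)
      · exact Subgroup.mem_sup_left (Subgroup.mem_closure_singleton_self _)
      · exact Subgroup.mem_sup_right (Subgroup.mem_closure_singleton_self _)
      · rw [h]
        have hb : (b : G) ∈ Subgroup.closure {(a : G)} ⊔ Subgroup.closure {(b : G)} :=
          Subgroup.mem_sup_right (Subgroup.mem_closure_singleton_self _)
        have ha : (a : G) ∈ Subgroup.closure {(a : G)} ⊔ Subgroup.closure {(b : G)} :=
          Subgroup.mem_sup_left (Subgroup.mem_closure_singleton_self _)
        exact mul_mem (mul_mem (inv_mem hb) ha) hb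
    | left a b d h =>
      simp only [wordSubgroup_mul, wordSubgroup_of]
      have hb' : (b : G) = (a : G)⁻¹ * d * a := by rw [h]; group
      apply le_antisymm <;> refine sup_le ?_ ?_ <;> rw [Subgroup.closure_le,
        Set.singleton_subset_iff, SetLike.mem_coe]
      · exact Subgroup.mem_sup_right (Subgroup.mem_closure_singleton_self _)
      · rw [hb']
        have ha : (a : G) ∈ Subgroup.closure {(d : G)} ⊔ Subgroup.closure {(a : G)} :=
          Subgroup.mem_sup_right (Subgroup.mem_closure_singleton_self _)
        have hd : (d : G) ∈ Subgroup.closure {(d : G)} ⊔ Subgroup.closure {(a : G)} :=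
          Subgroup.mem_sup_left (Subgroup.mem_closure_singleton_self _)
        exact mul_mem (mul_mem (inv_mem ha) hd) ha
      · rw [h]
        have hb : (b : G) ∈ Subgroup.closure {(a : G)} ⊔ Subgroup.closure {(b : G)} :=
          Subgroup.mem_sup_right (Subgroup.mem_closure_singleton_self _)
        have ha : (a : G) ∈ Subgroup.closure {(a : G)} ⊔ Subgroup.closure {(b : G)} :=
          Subgroup.mem_sup_left (Subgroup.mem_closure_singleton_self _)
        exact mul_mem (mul_mem ha hb) (inv_mem ha)
      · exact Subgroup.mem_sup_left (Subgroup.mem_closure_singleton_self _)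
  exact hc h

/-- `G_s`, the subgroup of `G` generated by the factors of `s ∈ S(G, O)`; it does not depend on
the chosen word. -/
def factorSubgroup (O : Set G) (s : FactSemigroup O) : Subgroup G :=
  Quotient.lift (s := (conGen (FactRel O)).toSetoid) (wordSubgroup O)
    (fun _ _ h => wordSubgroup_eq_of_rel O h) s

/-- `S(G, O)^H = {s | G_s = H}`. -/
def withFactorSubgroup (O : Set G) (H : Subgroup G) : Set (FactSemigroup O) :=
  {s | factorSubgroup O s = H}

/-- The conjugacy classes `C_i` of `G` which `O` is composed of. -/
abbrev Classes (O : Set G) : Type u := {c : ConjClasses G // ∃ g ∈ O, ConjClasses.mk g = c}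

/-- The class of `g ∈ O`. -/
def classOf (O : Set G) (g : O) : Classes O := ⟨ConjClasses.mk (g : G), g, g.2, rfl⟩

open Classical in
/-- The type homomorphism `τ : S(G, O) → ℕ^m`, sending `x_g` with `g ∈ C_i` to the `i`-th standard
basis vector. -/
noncomputable def typeHom (O : Set G) : FactSemigroup O →* Multiplicative (Classes O → ℕ) :=
  PresentedMonoid.lift (fun g : O => Multiplicative.ofAdd (Pi.single (classOf O g) 1)) (by
    intro v w h
    cases h with
    | right a b c h =>
      have hc : classOf O c = classOf O a := by
        apply Subtype.ext
        refine (ConjClasses.mk_eq_mk_iff_isConj).2 (isConj_iff.2 ⟨(b : G), ?_⟩)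
        rw [h]; group
      simp [hc, mul_comm]
    | left a b c h =>
      have hc : classOf O c = classOf O b := by
        apply Subtype.ext
        refine (ConjClasses.mk_eq_mk_iff_isConj).2 (isConj_iff.2 ⟨(a : G)⁻¹, ?_⟩)
        rw [h]; group
      simp [hc, mul_comm])

/-- The type `τ(s) = (τ_i(s))_i` : `τ_i(s)` is the number of factors of `s` lying in `C_i`. -/
noncomputable def type (O : Set G) (s : FactSemigroup O) : Classes O → ℕ :=
  Multiplicative.toAdd (typeHom O s)

/-! ### The `C`-graph, the `C`-group and the ambiguity index -/

/-- A directed graph on `V` whose edges are labelled by vertices; `Edge v₁ v₂ v` means that there is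
an edge with tail `v₁`, head `v₂` and label `v`. -/
structure LabeledDigraph (V : Type u) where
  Edge : V → V → V → Prop

/-- The relators `y_v⁻¹ y_{v₁} y_v y_{v₂}⁻¹`, one for each edge of the labelled graph. -/
def LabeledDigraph.relators {V : Type u} (Γ : LabeledDigraph V) : Set (FreeGroup V) :=
  {r | ∃ v₁ v₂ v : V, Γ.Edge v₁ v₂ v ∧
    r = (FreeGroup.of v)⁻¹ * FreeGroup.of v₁ * FreeGroup.of v * (FreeGroup.of v₂)⁻¹}

/-- The group `G_Γ` generated by the vertices of `Γ` subject to the relations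
`y_v⁻¹ y_{v₁} y_v = y_{v₂}`, one for each edge. -/
abbrev LabeledDigraph.CGroup {V : Type u} (Γ : LabeledDigraph V) : Type u :=
  PresentedGroup Γ.relators

/-- The `C`-graph `Γ_(G,O)`: its vertices are the elements of `O`, and there is an edge from `g₁` to
`g₂` with label `g` if and only if `g⁻¹ g₁ g = g₂`. -/
def cGraph (O : Set G) : LabeledDigraph O where
  Edge g₁ g₂ g := (g : G)⁻¹ * g₁ * g = g₂

/-- The natural homomorphism `β : G_Γ → G`, `y_g ↦ g`, for `Γ = Γ_(G,O)`. -/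
def beta (O : Set G) : (cGraph O).CGroup →* G :=
  PresentedGroup.toGroup (f := fun g : O => (g : G)) (by
    rintro r ⟨v₁, v₂, v, h, rfl⟩
    change (v : G)⁻¹ * v₁ * v = v₂ at h
    simp [h])

/-- The ambiguity index `a_(G,O) = |ker β ∩ [G_Γ, G_Γ]|`. -/
noncomputable def ambiguityIndex (O : Set G) : ℕ :=
  Nat.card ↥((beta O).ker ⊓ commutator (cGraph O).CGroup)

end EquippedGroup

/-! Let φ = `toCGroup` map S(G,O) to G_Γ by x_g ↦ y_g. If O generates G, two elements of S(G,O) with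
the same type and product have images that differ by an element of K = ker β ∩ [G_Γ, G_Γ];
conversely, translating the image by K preserves both invariants. So it suffices that, among
elements of a fixed large type generating G, φ is injective and its image is a full K-coset.

Both facts come from the central elements x_g^|G|. Every x_g divides their product Z, so setting Z =
1 makes the generators invertible, and φ(s) = φ(t) with equal types gives Z^k s = Z^k t for some k
(`exists_centralAll_pow_mul_eq_of_type_eq`). Next to a factor generating G, x_g^|G| depends only on
the class of g (`centralPow_mul_eq`), so every element generating G is a product of such central
powers and one of finitely many elements b of bounded type (`exists_eq_centralProd_mul`). Finitely
many pairs (b, b') then give a uniform threshold for cancellation.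

For surjectivity, ker β is central of finite index, so [G_Γ, G_Γ] is finite by Schur's theorem.
Hence one power of φ(Z) moves all of K into the image of φ, and every s of large type is divisible
by that power of Z. -/

namespace EquippedGroup

open Finset

universe u

variable {G : Type u} [Group G]

/-! ### Words in the factorization semigroup -/

/-- The action of an element of the ambient group on `O` by conjugation. -/
def IsEquipped.conj {O : Set G} (hO : IsEquipped O) (g : G) (x : O) : O :=
  ⟨g * x * g⁻¹, hO.conj_mem g x x.2⟩

@[elab_as_elim]
theorem factSemigroup_induction {O : Set G} {p : FactSemigroup O → Prop} (s : FactSemigroup O)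
    (one : p 1) (gen_mul : ∀ a s, p s → p (gen O a * s)) : p s := by
  obtain ⟨w, rfl⟩ := PresentedMonoid.surjective_mk s
  induction w using FreeMonoid.inductionOn' with
  | one => exact one
  | of_mul a w ih => exact gen_mul a _ ih

theorem gen_mul_gen {O : Set G} (hO : IsEquipped O) (a b : O) :
    gen O a * gen O b = gen O (hO.conj a b) * gen O a :=
  PresentedMonoid.mk_eq_mk_of_rel (FactRel.left a b _ rfl)

theorem gen_pow_mul_gen {O : Set G} (hO : IsEquipped O) (a b : O) (n : ℕ) :
    gen O a ^ n * gen O b = gen O (hO.conj ((a : G) ^ n) b) * gen O a ^ n := by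
  induction n with
  | zero =>
    have : hO.conj ((a : G) ^ 0) b = b := Subtype.ext (by simp [IsEquipped.conj])
    rw [pow_zero, one_mul, mul_one, this]
  | succ n ih =>
    have : hO.conj ((a : G) ^ (n + 1)) b = hO.conj a (hO.conj ((a : G) ^ n) b) :=
      Subtype.ext (by simp [IsEquipped.conj, pow_succ', mul_assoc])
    rw [pow_succ', mul_assoc, ih, ← mul_assoc, gen_mul_gen hO, this, mul_assoc]

theorem gen_mul_gen_pow {O : Set G} (hO : IsEquipped O) (a b : O) (n : ℕ) :
    gen O a * gen O b ^ n = gen O (hO.conj a b) ^ n * gen O a := by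
  induction n with
  | zero => simp
  | succ n ih => rw [pow_succ, ← mul_assoc, ih, mul_assoc, gen_mul_gen hO, pow_succ, mul_assoc]

theorem factorSubgroup_mul (O : Set G) (s t : FactSemigroup O) :
    factorSubgroup O (s * t) = factorSubgroup O s ⊔ factorSubgroup O t := by
  obtain ⟨v, rfl⟩ := PresentedMonoid.surjective_mk s
  obtain ⟨w, rfl⟩ := PresentedMonoid.surjective_mk t
  exact wordSubgroup_mul O v w

theorem factorSubgroup_gen (O : Set G) (a : O) :
    factorSubgroup O (gen O a) = Subgroup.closure {(a : G)} :=
  wordSubgroup_of O a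

theorem factorSubgroup_one (O : Set G) : factorSubgroup O 1 = ⊥ :=
  (congrArg Subgroup.closure (by ext; simp)).trans Subgroup.closure_empty

theorem factorSubgroup_le_closure (O : Set G) (s : FactSemigroup O) :
    factorSubgroup O s ≤ Subgroup.closure O := by
  induction s using factSemigroup_induction with
  | one => simp [factorSubgroup_one]
  | gen_mul a s ih =>
    rw [factorSubgroup_mul, factorSubgroup_gen]
    exact sup_le (Subgroup.closure_mono (by simp)) ih

theorem mul_mem_withFactorSubgroup_top {O : Set G} {t : FactSemigroup O} (s : FactSemigroup O)
    (ht : t ∈ withFactorSubgroup O ⊤) : s * t ∈ withFactorSubgroup O ⊤ := by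
  change factorSubgroup O _ = ⊤
  rw [factorSubgroup_mul, show factorSubgroup O t = ⊤ from ht, sup_top_eq]

@[simp]
theorem type_one (O : Set G) : type O 1 = 0 := by
  simp [type]

@[simp]
theorem type_mul (O : Set G) (s t : FactSemigroup O) : type O (s * t) = type O s + type O t := by
  simp [type]

@[simp]
theorem type_pow (O : Set G) (s : FactSemigroup O) (n : ℕ) : type O (s ^ n) = n • type O s := by
  simp [type]

open Classical in
theorem type_gen (O : Set G) (a : O) : type O (gen O a) = Pi.single (classOf O a) 1 :=
  rfl

theorem sum_type_mk (O : Set G) [Fintype (Classes O)] (w : FreeMonoid O) :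
    ∑ i, type O (PresentedMonoid.mk _ w) i = w.toList.length := by
  classical
  induction w using FreeMonoid.inductionOn' with
  | one => simp
  | of_mul a w ih =>
    have h : PresentedMonoid.mk (FactRel O) (FreeMonoid.of a) = gen O a := rfl
    rw [map_mul, h, type_mul, type_gen]
    simp [sum_add_distrib, ih, add_comm]

theorem finite_setOf_type_le (O : Set G) [Finite O] [Finite (Classes O)] (n : ℕ) :
    {s : FactSemigroup O | ∀ i, type O s i ≤ n}.Finite := by
  have := Fintype.ofFinite (Classes O)
  refine ((List.finite_length_le O (∑ _i : Classes O, n)).image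
    fun l => PresentedMonoid.mk (FactRel O) (FreeMonoid.ofList l)).subset fun s hs => ?_
  obtain ⟨w, rfl⟩ := PresentedMonoid.surjective_mk s
  exact ⟨w.toList, (sum_type_mk O w).symm.trans_le (sum_le_sum fun i _ => hs i), rfl⟩

open Classical in
theorem type_mk_apply (O : Set G) [Fintype O] (w : FreeMonoid O) (i : Classes O) :
    type O (PresentedMonoid.mk _ w) i =
      ∑ g, if classOf O g = i then w.toList.count g else 0 := by
  induction w using FreeMonoid.inductionOn' with
  | one => simp
  | of_mul a w ih =>
    have h : PresentedMonoid.mk (FactRel O) (FreeMonoid.of a) = gen O a := rfl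
    have h' (g : O) : (if classOf O g = i then (FreeMonoid.of a * w).toList.count g else 0) =
        (if g = a then if classOf O a = i then 1 else 0 else 0) +
          if classOf O g = i then w.toList.count g else 0 := by
      by_cases hg : g = a <;> by_cases hi : classOf O g = i <;>
        simp_all [eq_comm, add_comm]
    rw [map_mul, h, type_mul, type_gen, Pi.add_apply, ih, sum_congr rfl fun g _ => h' g,
      sum_add_distrib, sum_ite_eq' univ a]
    simp [Pi.single_apply, eq_comm]

-- Occurrences of g move left past any other letter unchanged; only the letter passed is conjugated.
open Classical in
theorem exists_mk_eq_gen_pow_mul {O : Set G} (hO : IsEquipped O) (w : FreeMonoid O) (g : O) :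
    ∃ t, PresentedMonoid.mk (FactRel O) w = gen O g ^ w.toList.count g * t := by
  induction w using FreeMonoid.inductionOn' with
  | one => exact ⟨1, by simp⟩
  | of_mul a w ih =>
    obtain ⟨t, ht⟩ := ih
    have h : PresentedMonoid.mk (FactRel O) (FreeMonoid.of a) = gen O a := rfl
    rw [map_mul, h, ht]
    by_cases hg : a = g
    · subst hg
      exact ⟨t, by simp [pow_succ', mul_assoc]⟩
    · let b : O := hO.conj (((g : G) ^ w.toList.count g)⁻¹) a
      have hb : hO.conj ((g : G) ^ w.toList.count g) b = a :=
        Subtype.ext (by simp [b, IsEquipped.conj, mul_assoc])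
      refine ⟨gen O b * t, ?_⟩
      have hc : (FreeMonoid.of a * w).toList.count g = w.toList.count g := by
        simp [hg]
      rw [hc, ← mul_assoc, ← mul_assoc, gen_pow_mul_gen hO, hb]

/-- A generator occurring in `s` with multiplicity greater than `n` exists in every class whose
type is large; `n` of its occurrences can be split off without changing the generated subgroup. -/
theorem exists_eq_gen_pow_mul {O : Set G} (hO : IsEquipped O) [Finite O] {s : FactSemigroup O}
    {i : Classes O} {n : ℕ} (h : Nat.card O * n < type O s i) :
    ∃ g t, classOf O g = i ∧ s = gen O g ^ n * t ∧ factorSubgroup O t = factorSubgroup O s := by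
  classical
  have := Fintype.ofFinite O
  obtain ⟨w, rfl⟩ := PresentedMonoid.surjective_mk s
  rw [type_mk_apply] at h
  -- Pigeonhole over the letters of the class i.
  obtain ⟨g, -, hg⟩ : ∃ g ∈ univ, n < if classOf O g = i then w.toList.count g else 0 := by
    by_contra! hn
    refine h.not_ge ((sum_le_card_nsmul univ _ n hn).trans ?_)
    simp [Nat.card_eq_fintype_card]
  split_ifs at hg with hi
  · obtain ⟨t, ht⟩ := exists_mk_eq_gen_pow_mul hO w g
    obtain ⟨k, hk⟩ := Nat.exists_eq_add_of_lt hg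
    -- The strict inequality leaves one further copy of g in the cofactor, which therefore still
    -- generates the same subgroup.
    have hs : PresentedMonoid.mk (FactRel O) w = gen O g ^ n * (gen O g * (gen O g ^ k * t)) := by
      rw [ht, hk, show n + k + 1 = n + (1 + k) by omega, pow_add, pow_add, pow_one]
      simp only [mul_assoc]
    refine ⟨g, _, hi, hs, ?_⟩
    rw [hs, factorSubgroup_mul _ (_ ^ n)]
    refine (sup_eq_right.2 ?_).symm
    have hle : ∀ m : ℕ, factorSubgroup O (gen O g ^ m) ≤ Subgroup.closure {(g : G)} := by
      intro m
      induction m with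
      | zero => simp [factorSubgroup_one]
      | succ m ih => simpa [pow_succ, factorSubgroup_mul, factorSubgroup_gen] using ih
    rw [factorSubgroup_mul, factorSubgroup_gen]
    exact (hle n).trans le_sup_left
  · omega

/-! ### Central elements -/

/-- The central element `x_g ^ |G|` of the factorization semigroup. -/
noncomputable def centralPow {O : Set G} (hO : IsEquipped O) [Finite G] (g : O) :
    Submonoid.center (FactSemigroup O) :=
  ⟨gen O g ^ Nat.card G, Submonoid.mem_center_iff.2 fun s => by
    induction s using factSemigroup_induction with
    | one => simp
    | gen_mul a s ih =>
      have h := gen_pow_mul_gen hO g a (Nat.card G)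
      have ha : hO.conj ((g : G) ^ Nat.card G) a = a :=
        Subtype.ext (by simp [IsEquipped.conj, pow_card_eq_one'])
      rw [ha] at h
      rw [mul_assoc, ih, ← mul_assoc, ← h, mul_assoc]⟩

/-- By centrality x_g^|G| can be carried to any letter x_a of s; crossing x_a conjugates g by a, and
the result is carried back. The elements a that work form a subgroup containing every letter. -/
theorem centralPow_conj_mul {O : Set G} (hO : IsEquipped O) [Finite G] {s : FactSemigroup O}
    {a : G} (ha : a ∈ factorSubgroup O s) (g : O) :
    (centralPow hO (hO.conj a g) : FactSemigroup O) * s = centralPow hO g * s := by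
  let H : Subgroup G :=
    { carrier := {a | ∀ g, (centralPow hO (hO.conj a g) : FactSemigroup O) * s =
        centralPow hO g * s}
      one_mem' := fun g => by simp [IsEquipped.conj]
      mul_mem' := fun {a b} ha hb g => by
        have : hO.conj (a * b) g = hO.conj a (hO.conj b g) :=
          Subtype.ext (by simp [IsEquipped.conj, mul_assoc])
        rw [this, ha, hb]
      inv_mem' := fun {a} ha g => by
        rw [← ha (hO.conj a⁻¹ g)]
        congr 3
        exact Subtype.ext (by simp [IsEquipped.conj, mul_assoc]) }
  -- Induction runs over suffixes t with s, hence H, held fixed.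
  suffices h : ∀ t u, s = u * t → factorSubgroup O t ≤ H from h s 1 (by simp) ha g
  intro t
  induction t using factSemigroup_induction with
  | one => simp [factorSubgroup_one]
  | gen_mul a t ih =>
    intro u hu
    rw [factorSubgroup_mul, factorSubgroup_gen]
    refine sup_le ?_ (ih (u * gen O a) (by rw [hu, mul_assoc]))
    rw [Subgroup.closure_le, Set.singleton_subset_iff]
    intro g
    have hc (g : O) (v : FactSemigroup O) := Submonoid.mem_center_iff.1 (centralPow hO g).2 v
    have h : gen O a * (centralPow hO g : FactSemigroup O) =
        centralPow hO (hO.conj a g) * gen O a := gen_mul_gen_pow hO a g _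
    rw [hu, ← mul_assoc, ← hc, ← mul_assoc (centralPow hO g : FactSemigroup O), ← hc g, mul_assoc,
      mul_assoc, ← mul_assoc _ (gen O a), ← mul_assoc _ (gen O a), ← h, hc g]

theorem centralPow_mul_eq {O : Set G} (hO : IsEquipped O) [Finite G] {s : FactSemigroup O}
    (hs : s ∈ withFactorSubgroup O ⊤) {g h : O} (hgh : classOf O g = classOf O h) :
    (centralPow hO g : FactSemigroup O) * s = centralPow hO h * s := by
  obtain ⟨a, ha⟩ := isConj_iff.1 (ConjClasses.mk_eq_mk_iff_isConj.1 (congrArg Subtype.val hgh))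
  have hs' : factorSubgroup O s = ⊤ := hs
  rw [← centralPow_conj_mul hO (a := a) (by simp [hs']) g,
    show hO.conj a g = h from Subtype.ext ha]

theorem exists_classOf_eq (O : Set G) (i : Classes O) : ∃ g, classOf O g = i := by
  obtain ⟨c, g, hg, rfl⟩ := i
  exact ⟨⟨g, hg⟩, rfl⟩

/-- A representative of a conjugacy class. -/
noncomputable def classRep (O : Set G) (i : Classes O) : O :=
  (exists_classOf_eq O i).choose

@[simp]
theorem classOf_classRep (O : Set G) (i : Classes O) : classOf O (classRep O i) = i :=
  (exists_classOf_eq O i).choose_spec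

/-- The product of central powers of class representatives with prescribed exponents. -/
noncomputable def centralProd {O : Set G} (hO : IsEquipped O) [Finite G] [Fintype (Classes O)]
    (κ : Classes O → ℕ) : Submonoid.center (FactSemigroup O) :=
  ∏ i, centralPow hO (classRep O i) ^ κ i

theorem centralProd_add {O : Set G} (hO : IsEquipped O) [Finite G] [Fintype (Classes O)]
    (κ l : Classes O → ℕ) : centralProd hO (κ + l) = centralProd hO κ * centralProd hO l := by
  simp [centralProd, pow_add, prod_mul_distrib]

theorem centralProd_nsmul {O : Set G} (hO : IsEquipped O) [Finite G] [Fintype (Classes O)]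
    (n : ℕ) (κ : Classes O → ℕ) : centralProd hO (n • κ) = centralProd hO κ ^ n := by
  simp [centralProd, prod_pow, pow_mul']

theorem type_centralPow {O : Set G} (hO : IsEquipped O) [Finite G] (g : O) :
    type O (centralPow hO g) = Nat.card G • type O (gen O g) :=
  type_pow O _ _

theorem type_prod {O : Set G} {ι : Type*} (t : Finset ι)
    (f : ι → Submonoid.center (FactSemigroup O)) :
    type O (∏ j ∈ t, f j : Submonoid.center (FactSemigroup O)) = ∑ j ∈ t, type O (f j) := by
  classical
  induction t using Finset.induction_on with
  | empty => simp
  | insert a t ha ih => simp [prod_insert ha, sum_insert ha, ih]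

theorem type_centralProd {O : Set G} (hO : IsEquipped O) [Finite G] [Fintype (Classes O)]
    (κ : Classes O → ℕ) : type O (centralProd hO κ) = Nat.card G • κ := by
  classical
  ext i
  simp [centralProd, type_prod, type_centralPow, type_gen, Pi.single_apply, mul_comm]

/-- The product of all central powers `x_g ^ |G|`, `g ∈ O`. -/
noncomputable def centralAll {O : Set G} (hO : IsEquipped O) [Finite G] [Fintype O] :
    Submonoid.center (FactSemigroup O) :=
  ∏ g, centralPow hO g

open Classical in
/-- The number of elements of `O` in each conjugacy class. -/
noncomputable def classCard (O : Set G) [Fintype O] (i : Classes O) : ℕ :=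
  #{g : O | classOf O g = i}

theorem centralAll_mul {O : Set G} (hO : IsEquipped O) [Finite G] [Fintype O]
    [Fintype (Classes O)] {s : FactSemigroup O} (hs : s ∈ withFactorSubgroup O ⊤) :
    (centralAll hO : FactSemigroup O) * s = centralProd hO (classCard O) * s := by
  classical
  have h : centralProd hO (classCard O) = ∏ g, centralPow hO (classRep O (classOf O g)) := by
    rw [centralProd, ← prod_fiberwise_of_maps_to' (g := classOf O) (s := univ) (t := univ) (by simp)
      (fun i => centralPow hO (classRep O i))]
    simp [classCard]
  rw [h, centralAll]
  generalize (univ : Finset O) = t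
  induction t using Finset.induction_on with
  | empty => simp
  | insert a t ha ih =>
    rw [prod_insert ha, prod_insert ha, Submonoid.coe_mul, Submonoid.coe_mul, mul_assoc, mul_assoc,
      ih]
    exact centralPow_mul_eq hO (mul_mem_withFactorSubgroup_top _ hs) (by simp)

theorem centralAll_pow_mul {O : Set G} (hO : IsEquipped O) [Finite G] [Fintype O]
    [Fintype (Classes O)] {s : FactSemigroup O} (hs : s ∈ withFactorSubgroup O ⊤) (k : ℕ) :
    (centralAll hO : FactSemigroup O) ^ k * s = centralProd hO (k • classCard O) * s := by
  rw [centralProd_nsmul, SubmonoidClass.coe_pow]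
  induction k with
  | zero => simp
  | succ k ih =>
    rw [pow_succ', mul_assoc, ih, centralAll_mul hO (mul_mem_withFactorSubgroup_top _ hs),
      ← mul_assoc, ← pow_succ']

theorem type_centralAll_apply_pos {O : Set G} (hO : IsEquipped O) [Finite G] [Fintype O]
    (i : Classes O) : 0 < type O (centralAll hO) i := by
  classical
  rw [centralAll, type_prod, Finset.sum_apply]
  refine sum_pos' (by simp) ⟨classRep O i, by simp, ?_⟩
  simp [type_centralPow, type_gen, Nat.card_pos]

theorem exists_eq_centralPow_mul {O : Set G} (hO : IsEquipped O) [Finite G]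
    {s : FactSemigroup O} (hs : s ∈ withFactorSubgroup O ⊤) {i : Classes O}
    (h : Nat.card O * Nat.card G < type O s i) :
    ∃ t ∈ withFactorSubgroup O ⊤, s = centralPow hO (classRep O i) * t := by
  obtain ⟨g, t, hg, hst, ht⟩ := exists_eq_gen_pow_mul hO h
  have ht' : t ∈ withFactorSubgroup O ⊤ := ht.trans hs
  exact ⟨t, ht', hst.trans (centralPow_mul_eq hO ht' (by simp [hg]))⟩

/-- Every element generating `G` is a central multiple of one of bounded type. -/
theorem exists_eq_centralProd_mul {O : Set G} (hO : IsEquipped O) [Finite G]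
    [Fintype (Classes O)] (s : FactSemigroup O) (hs : s ∈ withFactorSubgroup O ⊤) :
    ∃ κ, ∃ b ∈ withFactorSubgroup O ⊤, (∀ i, type O b i ≤ Nat.card O * Nat.card G) ∧
      s = centralProd hO κ * b := by
  classical
  induction hn : ∑ i, type O s i using Nat.strong_induction_on generalizing s with
  | _ n ih =>
    by_cases h : ∀ i, type O s i ≤ Nat.card O * Nat.card G
    · exact ⟨0, s, hs, h, by simp [centralProd]⟩
    push Not at h
    obtain ⟨i, hi⟩ := h
    obtain ⟨t, ht, rfl⟩ := exists_eq_centralPow_mul hO hs hi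
    have hlt : ∑ j, type O t j < n := by
      rw [← hn]
      refine sum_lt_sum (fun j _ => by simp) ⟨i, by simp, ?_⟩
      simp [type_centralPow, type_gen, Nat.card_pos]
    obtain ⟨κ, b, hb, hb', rfl⟩ := ih _ hlt t ht rfl
    refine ⟨Pi.single i 1 + κ, b, hb, hb', ?_⟩
    have : centralProd hO (Pi.single i 1) = centralPow hO (classRep O i) := by
      rw [centralProd, prod_eq_single i (fun j _ hj => by simp [hj]) (by simp)]
      simp
    rw [centralProd_add, this, Submonoid.coe_mul, mul_assoc]

/-! ### The map to the `C`-group -/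

/-- The natural homomorphism from the factorization semigroup to the `C`-group. -/
def toCGroup (O : Set G) : FactSemigroup O →* (cGraph O).CGroup :=
  PresentedMonoid.lift (fun g : O => PresentedGroup.of g) (by
    have key (a b c : O) (h : (b : G)⁻¹ * a * b = c) :
        (PresentedGroup.of a * PresentedGroup.of b : (cGraph O).CGroup) =
          PresentedGroup.of b * PresentedGroup.of c := by
      have h1 : ((PresentedGroup.of b)⁻¹ * PresentedGroup.of a * PresentedGroup.of b *
          (PresentedGroup.of c)⁻¹ : (cGraph O).CGroup) = 1 :=
        PresentedGroup.one_of_mem (rels := (cGraph O).relators) ⟨a, c, b, h, rfl⟩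
      rw [mul_inv_eq_one, mul_assoc, inv_mul_eq_iff_eq_mul] at h1
      exact h1
    intro v w h
    cases h with
    | right a b c h => simpa using key a b c h.symm
    | left a b c h => simpa using (key c a b (by rw [h]; group)).symm)

@[simp]
theorem toCGroup_gen (O : Set G) (a : O) : toCGroup O (gen O a) = PresentedGroup.of a :=
  rfl

@[simp]
theorem beta_of (O : Set G) (a : O) : beta O (PresentedGroup.of a) = a :=
  PresentedGroup.toGroup.of _

theorem beta_toCGroup (O : Set G) (s : FactSemigroup O) :
    beta O (toCGroup O s) = prodHom O s := by
  have : (beta O).comp (toCGroup O) = prodHom O := PresentedMonoid.ext _ fun a => beta_of O a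
  exact DFunLike.congr_fun this s

@[elab_as_elim]
theorem cGroup_induction {O : Set G} {p : (cGraph O).CGroup → Prop} (γ : (cGraph O).CGroup)
    (one : p 1) (of_mul : ∀ a γ, p γ → p (PresentedGroup.of a * γ))
    (inv_of_mul : ∀ a γ, p γ → p ((PresentedGroup.of a)⁻¹ * γ)) : p γ := by
  have h : γ ∈ Subgroup.closure (Set.range (PresentedGroup.of (rels := (cGraph O).relators))) := by
    simp
  induction h using Subgroup.closure_induction_left with
  | one => exact one
  | mul_left x hx y _ ih =>
    obtain ⟨a, rfl⟩ := hx
    exact of_mul a y ih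
  | inv_mul_cancel x hx y _ ih =>
    obtain ⟨a, rfl⟩ := hx
    exact inv_of_mul a y ih

/-- Conjugation in G_Γ acts on the generators through β, which is why ker β is central. -/
theorem conj_of {O : Set G} (hO : IsEquipped O) (γ : (cGraph O).CGroup) (a : O) :
    γ * PresentedGroup.of a * γ⁻¹ = PresentedGroup.of (hO.conj (beta O γ) a) := by
  have h (a b : O) : (PresentedGroup.of a * PresentedGroup.of b * (PresentedGroup.of a)⁻¹ :
      (cGraph O).CGroup) = PresentedGroup.of (hO.conj a b) := by
    rw [mul_inv_eq_iff_eq_mul]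
    simpa using congrArg (toCGroup O) (gen_mul_gen hO a b)
  induction γ using cGroup_induction with
  | one => simp [IsEquipped.conj]
  | of_mul b γ ih =>
    have : (PresentedGroup.of b * γ) * PresentedGroup.of a * (PresentedGroup.of b * γ)⁻¹ =
        PresentedGroup.of b * (γ * PresentedGroup.of a * γ⁻¹) * (PresentedGroup.of b)⁻¹ := by
      group
    rw [this, ih, h]
    congr 1
    exact Subtype.ext (by simp [IsEquipped.conj, mul_assoc])
  | inv_of_mul b γ ih =>
    have : ((PresentedGroup.of b)⁻¹ * γ) * PresentedGroup.of a * ((PresentedGroup.of b)⁻¹ * γ)⁻¹ =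
        (PresentedGroup.of b)⁻¹ * (γ * PresentedGroup.of a * γ⁻¹) * PresentedGroup.of b := by
      group
    rw [this, ih, mul_assoc, inv_mul_eq_iff_eq_mul, eq_comm, ← mul_inv_eq_iff_eq_mul, h]
    congr 1
    exact Subtype.ext (by simp [IsEquipped.conj, mul_assoc])

theorem ker_beta_le_center {O : Set G} (hO : IsEquipped O) :
    (beta O).ker ≤ Subgroup.center (cGraph O).CGroup := by
  intro γ hγ
  have h (a : O) : Commute (PresentedGroup.of a) γ := by
    have := conj_of hO γ a
    rw [MonoidHom.mem_ker.1 hγ, show hO.conj 1 a = a from Subtype.ext (by simp [IsEquipped.conj]),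
      mul_inv_eq_iff_eq_mul] at this
    exact this.symm
  refine Subgroup.mem_center_iff.2 fun δ => ?_
  change Commute δ γ
  induction δ using cGroup_induction with
  | one => exact Commute.one_left γ
  | of_mul a δ ih => exact (h a).mul_left ih
  | inv_of_mul a δ ih => exact (h a).inv_left.mul_left ih

/-! ### Finiteness of the ambiguity index -/

open scoped commutatorElement in
theorem commutatorElement_mul_center {H : Type*} [Group H] (g h : H) {c d : H}
    (hc : c ∈ Subgroup.center H) (hd : d ∈ Subgroup.center H) : ⁅g * c, h * d⁆ = ⁅g, h⁆ := by
  have h1 : c * (h * d) * c⁻¹ = h * d := by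
    rw [← Subgroup.mem_center_iff.1 hc, mul_inv_cancel_right]
  have h2 : d * g⁻¹ * d⁻¹ = g⁻¹ := by
    rw [← Subgroup.mem_center_iff.1 hd, mul_inv_cancel_right]
  calc ⁅g * c, h * d⁆ = g * (c * (h * d) * c⁻¹) * g⁻¹ * (h * d)⁻¹ := by
        simp only [commutatorElement_def]; group
    _ = g * h * (d * g⁻¹ * d⁻¹) * h⁻¹ := by rw [h1]; group
    _ = ⁅g, h⁆ := by rw [h2, commutatorElement_def]

open scoped commutatorElement in
theorem finite_commutatorSet_of_finiteIndex_center (H : Type*) [Group H]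
    [(Subgroup.center H).FiniteIndex] : Finite (commutatorSet H) := by
  have := Subgroup.finite_quotient_of_finiteIndex (H := Subgroup.center H)
  refine Set.Finite.subset (Set.finite_range
    fun p : (H ⧸ Subgroup.center H) × (H ⧸ Subgroup.center H) => ⁅p.1.out, p.2.out⁆) ?_
  rintro _ ⟨g, h, rfl⟩
  obtain ⟨x, hx⟩ := QuotientGroup.mk_out_eq_mul (Subgroup.center H) g
  obtain ⟨y, hy⟩ := QuotientGroup.mk_out_eq_mul (Subgroup.center H) h
  exact ⟨(g, h), by simp only [hx, hy, commutatorElement_mul_center g h x.2 y.2]⟩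

theorem finite_ker_beta_inf_commutator {O : Set G} [Finite G] (hO : IsEquipped O) :
    Finite ↥((beta O).ker ⊓ commutator (cGraph O).CGroup) := by
  have : (beta O).ker.FiniteIndex := inferInstance
  have : (Subgroup.center (cGraph O).CGroup).FiniteIndex :=
    Subgroup.finiteIndex_of_le (ker_beta_le_center hO)
  have := finite_commutatorSet_of_finiteIndex_center (cGraph O).CGroup
  -- Schur: finitely many commutators give a finite commutator subgroup.
  exact Finite.of_injective (Subgroup.inclusion inf_le_right) (Subgroup.inclusion_injective _)

/-- Two elements of the factorization semigroup of the same type have images in the `C`-group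
which agree modulo commutators. -/
theorem abelianization_toCGroup_eq {O : Set G} (hO : IsEquipped O)
    (hG : Subgroup.closure O = ⊤) [Finite (Classes O)] {s t : FactSemigroup O}
    (h : type O s = type O t) :
    Abelianization.of (toCGroup O s) = Abelianization.of (toCGroup O t) := by
  classical
  have := Fintype.ofFinite (Classes O)
  have hsurj : Function.Surjective (beta O) := by
    rw [← MonoidHom.range_eq_top, eq_top_iff, ← hG, Subgroup.closure_le]
    exact fun g hg => ⟨PresentedGroup.of ⟨g, hg⟩, beta_of O _⟩
  -- Since β is onto, elements of O conjugate in G have generators conjugate in G_Γ.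
  have hrep (a : O) : Abelianization.of (PresentedGroup.of a : (cGraph O).CGroup) =
      Abelianization.of (PresentedGroup.of (classRep O (classOf O a))) := by
    obtain ⟨g, hg⟩ := isConj_iff.1 (ConjClasses.mk_eq_mk_iff_isConj.1
      (congrArg Subtype.val (classOf_classRep O (classOf O a)).symm))
    obtain ⟨γ, rfl⟩ := hsurj g
    rw [show classRep O (classOf O a) = hO.conj (beta O γ) a from Subtype.ext hg.symm,
      ← conj_of hO]
    simp
  have key (s : FactSemigroup O) : Abelianization.of (toCGroup O s) =
      ∏ i, Abelianization.of (PresentedGroup.of (classRep O i)) ^ type O s i := by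
    induction s using factSemigroup_induction with
    | one => simp
    | gen_mul a s ih =>
      simp only [map_mul, ih, type_mul, Pi.add_apply, pow_add, prod_mul_distrib, type_gen,
        toCGroup_gen]
      congr 1
      rw [Fintype.prod_eq_single (classOf O a) (fun i hi => by rw [Pi.single_eq_of_ne hi, pow_zero]),
        Pi.single_eq_same, pow_one, hrep a]
  rw [key, key, h]

/-- The type homomorphism factors through the `C`-group. -/
theorem type_eq_of_toCGroup_mul {O : Set G} {s t : FactSemigroup O}
    {k : (cGraph O).CGroup} (hk : k ∈ commutator (cGraph O).CGroup)
    (h : toCGroup O s = k * toCGroup O t) : type O s = type O t := by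
  classical
  let f : (cGraph O).CGroup →* Multiplicative (Classes O → ℤ) :=
    PresentedGroup.toGroup (f := fun g => Multiplicative.ofAdd (Pi.single (classOf O g) 1)) (by
      rintro r ⟨a, b, c, h, rfl⟩
      have hc : classOf O a = classOf O b := by
        refine Subtype.ext ((ConjClasses.mk_eq_mk_iff_isConj).2 (isConj_iff.2 ⟨(c : G)⁻¹, ?_⟩))
        change (c : G)⁻¹ * a * c = b at h
        simpa using h
      simp [hc])
  have hf (s : FactSemigroup O) : f (toCGroup O s) =
      Multiplicative.ofAdd fun i => (type O s i : ℤ) := by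
    induction s using factSemigroup_induction with
    | one => simp; rfl
    | gen_mul a s ih =>
      have : f (PresentedGroup.of a) = Multiplicative.ofAdd (Pi.single (classOf O a) 1) :=
        PresentedGroup.toGroup.of _
      rw [map_mul, map_mul, ih, toCGroup_gen, this, ← ofAdd_add]
      congr 1
      ext i
      simp [type_gen, Pi.single_apply]
  have hkf : f k = 1 := Abelianization.commutator_subset_ker f hk
  have := congrArg f h
  rw [map_mul, hkf, one_mul, hf, hf] at this
  ext i
  exact_mod_cast congrFun (Multiplicative.ofAdd.injective this) i

/-! ### Inverting the central element -/

theorem exists_gen_mul_eq_centralAll {O : Set G} (hO : IsEquipped O) [Finite G] [Fintype O]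
    (a : O) : ∃ w, gen O a * w = centralAll hO ∧ w * gen O a = centralAll hO := by
  classical
  obtain ⟨n, hn⟩ := Nat.exists_eq_add_of_lt (Nat.card_pos (α := G))
  rw [zero_add] at hn
  have h : (centralAll hO : FactSemigroup O) =
      gen O a ^ Nat.card G * (∏ g ∈ univ.erase a, centralPow hO g : Submonoid.center _) := by
    rw [centralAll, ← mul_prod_erase _ _ (mem_univ a), Submonoid.coe_mul]
    rfl
  refine ⟨gen O a ^ n * (∏ g ∈ univ.erase a, centralPow hO g : Submonoid.center _), ?_, ?_⟩
  · rw [h, hn, pow_succ', mul_assoc]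
  · rw [h, hn, pow_succ, mul_assoc, mul_assoc, Submonoid.mem_center_iff.1 (Subtype.prop _)]

/-- The congruence identifying the powers of the central element `centralAll` with `1`. -/
def centralAllCon {O : Set G} (hO : IsEquipped O) [Finite G] [Fintype O] :
    Con (FactSemigroup O) where
  r s t := ∃ j k : ℕ, (centralAll hO : FactSemigroup O) ^ j * s = (centralAll hO : _) ^ k * t
  iseqv :=
    { refl := fun s => ⟨0, 0, rfl⟩
      symm := fun ⟨j, k, h⟩ => ⟨k, j, h.symm⟩
      trans := fun {s t u} ⟨j, k, h⟩ ⟨l, m, h'⟩ => ⟨l + j, k + m, by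
        rw [pow_add, mul_assoc, h, ← mul_assoc, ← pow_add, add_comm l k, pow_add, mul_assoc, h',
          ← mul_assoc, ← pow_add]⟩ }
  mul' := fun {s t u v} ⟨j, k, h⟩ ⟨l, m, h'⟩ => by
    have hc (n : ℕ) (x : FactSemigroup O) :
        x * (centralAll hO : FactSemigroup O) ^ n = (centralAll hO : _) ^ n * x :=
      Submonoid.mem_center_iff.1 (pow_mem (centralAll hO).2 n) x
    refine ⟨j + l, k + m, ?_⟩
    rw [pow_add, mul_assoc, ← mul_assoc _ s u, ← hc l s, mul_assoc, ← mul_assoc, h, h', pow_add,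
      mul_assoc, mul_assoc, ← mul_assoc t, hc m t, mul_assoc]

/-- Modulo Z = 1 the generators are units satisfying the relations of G_Γ, so the quotient map
factors through `toCGroup`. -/
theorem exists_centralAll_pow_mul_eq {O : Set G} (hO : IsEquipped O) [Finite G] [Fintype O]
    {s t : FactSemigroup O} (h : toCGroup O s = toCGroup O t) :
    ∃ j k : ℕ, (centralAll hO : FactSemigroup O) ^ j * s = (centralAll hO : _) ^ k * t := by
  let c := centralAllCon hO
  have hZ : c.mk' (centralAll hO) = 1 := c.eq.2 ⟨0, 1, by simp⟩
  choose w hw hw' using exists_gen_mul_eq_centralAll hO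
  let y (a : O) : c.Quotientˣ :=
    ⟨c.mk' (gen O a), c.mk' (w a), by rw [← map_mul, hw, hZ], by rw [← map_mul, hw', hZ]⟩
  let f : (cGraph O).CGroup →* c.Quotientˣ := PresentedGroup.toGroup (f := y) (by
    rintro r ⟨a, b, d, h, rfl⟩
    have hb : hO.conj d b = a := Subtype.ext (by
      change (d : G)⁻¹ * a * d = b at h
      simp [IsEquipped.conj, ← h, mul_assoc])
    have hy : y d * y b = y a * y d := by
      ext
      change c.mk' _ * c.mk' _ = c.mk' _ * c.mk' _
      rw [← map_mul, gen_mul_gen hO, hb, map_mul]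
    simp only [map_mul, map_inv, FreeGroup.lift_apply_of]
    rw [mul_assoc _ (y a), ← hy, inv_mul_cancel_left, mul_inv_cancel])
  have hfy (a : O) : f (PresentedGroup.of a) = y a := PresentedGroup.toGroup.of _
  have hf : ((Units.coeHom _).comp f).comp (toCGroup O) = c.mk' := PresentedMonoid.ext _ fun a =>
    congrArg Units.val (hfy a)
  have hmk (u : FactSemigroup O) : c.mk' u = f (toCGroup O u) := (DFunLike.congr_fun hf u).symm
  exact c.eq.1 (by rw [← Con.coe_mk', hmk, hmk, h])

theorem exists_centralAll_pow_mul_eq_of_type_eq {O : Set G} (hO : IsEquipped O) [Finite G]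
    [Fintype O] {s t : FactSemigroup O} (h : toCGroup O s = toCGroup O t)
    (hst : type O s = type O t) :
    ∃ k : ℕ, (centralAll hO : FactSemigroup O) ^ k * s = (centralAll hO : _) ^ k * t := by
  obtain ⟨j, k, hjk⟩ := exists_centralAll_pow_mul_eq hO h
  rcases isEmpty_or_nonempty O with hE | ⟨⟨a⟩⟩
  · refine ⟨0, ?_⟩
    have (u : FactSemigroup O) : u = 1 := by
      induction u using factSemigroup_induction with
      | one => rfl
      | gen_mul a => exact isEmptyElim a
    rw [this s, this t]
  · have h1 := congrFun (congrArg (type O) hjk) (classOf O a)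
    -- Z has positive type in every class, so equal types force equal exponents.
    have h2 : j = k := by
      simpa [hst, (type_centralAll_apply_pos hO (classOf O a)).ne'] using h1
    exact ⟨k, h2 ▸ hjk⟩

/-- Every element of the `C`-group becomes the image of a semigroup element after multiplication
by a power of the central element. -/
theorem exists_toCGroup_eq_mul_pow {O : Set G} (hO : IsEquipped O) [Finite G] [Fintype O]
    (γ : (cGraph O).CGroup) :
    ∃ m : ℕ, ∀ n ≥ m, ∃ u, toCGroup O u = γ * toCGroup O (centralAll hO) ^ n := by
  have hc (n : ℕ) (x : FactSemigroup O) :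
      (centralAll hO : FactSemigroup O) ^ n * x = x * (centralAll hO : _) ^ n :=
    (Submonoid.mem_center_iff.1 (pow_mem (centralAll hO).2 n) x).symm
  induction γ using cGroup_induction with
  | one => exact ⟨0, fun n _ => ⟨(centralAll hO : FactSemigroup O) ^ n, by simp⟩⟩
  | of_mul a γ ih =>
    obtain ⟨m, hm⟩ := ih
    refine ⟨m, fun n hn => ?_⟩
    obtain ⟨u, hu⟩ := hm n hn
    exact ⟨gen O a * u, by rw [map_mul, hu, mul_assoc]; rfl⟩
  | inv_of_mul a γ ih =>
    obtain ⟨m, hm⟩ := ih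
    refine ⟨m + 1, fun n hn => ?_⟩
    obtain ⟨n, rfl⟩ := Nat.exists_eq_add_of_le' (Nat.le_of_add_left_le hn)
    obtain ⟨u, hu⟩ := hm n (by omega)
    obtain ⟨w, hw, -⟩ := exists_gen_mul_eq_centralAll hO a
    refine ⟨w * u, ?_⟩
    -- One extra factor Z turns the inverse generator into the image of w.
    have hZ : (PresentedGroup.of a)⁻¹ * toCGroup O (centralAll hO) = toCGroup O w := by
      rw [← hw, map_mul, toCGroup_gen, inv_mul_cancel_left]
    have hcomm : Commute (toCGroup O (centralAll hO)) (toCGroup O u) := by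
      simpa [commute_iff_eq] using congrArg (toCGroup O) (hc 1 u)
    rw [map_mul, ← hZ, mul_assoc, hcomm.eq, hu, pow_succ]
    simp only [mul_assoc]

/-! ### Elements of large type -/

/-- One coincidence for the pair b, b' suffices: after multiplying by a power of Z it is an equality
in the semigroup, and equality of types makes any pair with large κ a central translate of it. -/
theorem exists_centralProd_mul_eq {O : Set G} (hO : IsEquipped O) [Finite G] [Fintype O]
    [Fintype (Classes O)] {b b' : FactSemigroup O} (hb : b ∈ withFactorSubgroup O ⊤)
    (hb' : b' ∈ withFactorSubgroup O ⊤) :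
    ∃ n : ℕ, ∀ κ κ' : Classes O → ℕ, (∀ i, n ≤ κ i) →
      type O (centralProd hO κ * b) = type O (centralProd hO κ' * b') →
      toCGroup O (centralProd hO κ * b) = toCGroup O (centralProd hO κ' * b') →
      (centralProd hO κ * b : FactSemigroup O) = centralProd hO κ' * b' := by
  by_cases hex : ∃ κ κ' : Classes O → ℕ,
      type O (centralProd hO κ * b) = type O (centralProd hO κ' * b') ∧
      toCGroup O (centralProd hO κ * b) = toCGroup O (centralProd hO κ' * b')
  swap
  · exact ⟨0, fun κ κ' _ h1 h2 => absurd ⟨κ, κ', h1, h2⟩ hex⟩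
  obtain ⟨κ₀, κ₀', ht, hφ⟩ := hex
  obtain ⟨k, hk⟩ := exists_centralAll_pow_mul_eq_of_type_eq hO hφ ht
  rw [centralAll_pow_mul hO (mul_mem_withFactorSubgroup_top _ hb),
    centralAll_pow_mul hO (mul_mem_withFactorSubgroup_top _ hb'), ← mul_assoc, ← mul_assoc,
    ← Submonoid.coe_mul, ← Submonoid.coe_mul, ← centralProd_add, ← centralProd_add] at hk
  generalize k • classCard O + κ₀ = κ₁, k • classCard O + κ₀' = κ₁' at hk
  refine ⟨∑ i, κ₁ i, fun κ κ' hκ h _ => ?_⟩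
  have hle (i) : κ₁ i ≤ κ i := (single_le_sum (fun _ _ => Nat.zero_le _) (mem_univ i)).trans (hκ i)
  -- Types determine the difference of the exponents, so κ' is shifted by the same amount.
  have h1 : κ = (κ - κ₁) + κ₁ := (tsub_add_cancel_of_le hle).symm
  have h2 : κ' = (κ - κ₁) + κ₁' := by
    ext i
    have e1 := congrFun h i
    have e2 := congrFun (congrArg (type O) hk) i
    rw [h1] at e1
    simp only [type_mul, type_centralProd, Pi.add_apply, Pi.smul_apply, smul_eq_mul] at e1 e2
    refine Nat.eq_of_mul_eq_mul_left (Nat.card_pos (α := G)) ?_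
    simp only [Pi.add_apply]
    rw [mul_add] at e1 ⊢
    omega
  rw [h1, h2, centralProd_add, centralProd_add, Submonoid.coe_mul, Submonoid.coe_mul, mul_assoc,
    mul_assoc, hk]

/-- Elements generating `G` of large type are determined by their type and their image in the
`C`-group. -/
theorem exists_forall_eq_of_toCGroup_eq {O : Set G} (hO : IsEquipped O) [Finite G] :
    ∃ T : ℕ, ∀ s ∈ withFactorSubgroup O ⊤, ∀ t ∈ withFactorSubgroup O ⊤,
      (∀ i, T ≤ type O s i) → type O s = type O t → toCGroup O s = toCGroup O t → s = t := by
  have := Fintype.ofFinite O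
  have := Fintype.ofFinite (Classes O)
  let B : Set (FactSemigroup O) :=
    {b | b ∈ withFactorSubgroup O ⊤ ∧ ∀ i, type O b i ≤ Nat.card O * Nat.card G}
  have hB : B.Finite := (finite_setOf_type_le O _).subset fun b hb => hb.2
  have := hB.to_subtype
  choose n hn using fun p : B × B => exists_centralProd_mul_eq hO p.1.2.1 p.2.2.1
  obtain ⟨M, hM⟩ := (Set.finite_range n).bddAbove
  -- The type of s is |G|κ plus a part at most |O||G|, so this threshold forces κ ≥ M.
  refine ⟨Nat.card O * Nat.card G + Nat.card G * M, fun s hs t ht hT hst hφ => ?_⟩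
  obtain ⟨κ, b, hb, hb', rfl⟩ := exists_eq_centralProd_mul hO s hs
  obtain ⟨κ', c, hc, hc', rfl⟩ := exists_eq_centralProd_mul hO t ht
  refine hn (⟨b, hb, hb'⟩, ⟨c, hc, hc'⟩) κ κ' (fun i => (hM ⟨_, rfl⟩).trans ?_) hst hφ
  have h1 := hT i
  have h2 := hb' i
  simp only [type_mul, type_centralProd, Pi.add_apply, Pi.smul_apply, smul_eq_mul] at h1
  exact Nat.le_of_mul_le_mul_left (by omega) (Nat.card_pos (α := G))

/-- Elements generating `G` of large type are divisible by a given power of the central element. -/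
theorem exists_forall_eq_centralAll_pow_mul {O : Set G} (hO : IsEquipped O) [Finite G]
    [Fintype O] (m : ℕ) :
    ∃ T : ℕ, ∀ s ∈ withFactorSubgroup O ⊤, (∀ i, T ≤ type O s i) →
      ∃ t ∈ withFactorSubgroup O ⊤, s = (centralAll hO : FactSemigroup O) ^ m * t := by
  have := Fintype.ofFinite (Classes O)
  refine ⟨Nat.card O * Nat.card G + Nat.card G * ∑ i, m * classCard O i, fun s hs hT => ?_⟩
  obtain ⟨κ, b, hb, hb', rfl⟩ := exists_eq_centralProd_mul hO s hs
  have hle : m • classCard O ≤ κ := fun i => by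
    have h1 := hT i
    have h2 := hb' i
    simp only [type_mul, type_centralProd, Pi.add_apply, Pi.smul_apply, smul_eq_mul] at h1
    have h3 : ∑ i, m * classCard O i ≤ κ i :=
      Nat.le_of_mul_le_mul_left (by omega) (Nat.card_pos (α := G))
    exact (single_le_sum (f := fun i => m * classCard O i) (fun _ _ => Nat.zero_le _)
      (mem_univ i)).trans h3
  refine ⟨centralProd hO (κ - m • classCard O) * b, mul_mem_withFactorSubgroup_top _ hb, ?_⟩
  rw [centralAll_pow_mul hO (mul_mem_withFactorSubgroup_top _ hb), ← mul_assoc,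
    ← Submonoid.coe_mul, ← centralProd_add, add_tsub_cancel_of_le hle]

/-- Images of elements generating `G` of large type can be translated by any element of
`ker β ∩ [G_Γ, G_Γ]`. -/
theorem exists_forall_toCGroup_eq_mul {O : Set G} (hO : IsEquipped O) [Finite G] :
    ∃ T : ℕ, ∀ s ∈ withFactorSubgroup O ⊤, (∀ i, T ≤ type O s i) →
      ∀ k : ↥((beta O).ker ⊓ commutator (cGraph O).CGroup),
        ∃ t ∈ withFactorSubgroup O ⊤, toCGroup O t = k * toCGroup O s := by
  have := Fintype.ofFinite O
  have := finite_ker_beta_inf_commutator hO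
  choose m hm using fun k : ↥((beta O).ker ⊓ commutator (cGraph O).CGroup) =>
    exists_toCGroup_eq_mul_pow hO (k : (cGraph O).CGroup)
  obtain ⟨M, hM⟩ := (Set.finite_range m).bddAbove
  obtain ⟨T, hT⟩ := exists_forall_eq_centralAll_pow_mul hO M
  refine ⟨T, fun s hs hsT k => ?_⟩
  obtain ⟨t, ht, rfl⟩ := hT s hs hsT
  obtain ⟨u, hu⟩ := hm k M (hM ⟨k, rfl⟩)
  exact ⟨u * t, mul_mem_withFactorSubgroup_top _ ht, by simp only [map_mul, map_pow, hu, mul_assoc]⟩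

end EquippedGroup

theorem mainTheorem2 {G : Type*} [Group G] [Finite G] (O : Set G)
    (hO : EquippedGroup.IsEquipped O) :
    ∃ T : ℕ, ∀ s₁ ∈ EquippedGroup.withFactorSubgroup O ⊤,
      (∀ i : EquippedGroup.Classes O, T ≤ EquippedGroup.type O s₁ i) →
      ∃ s : Fin (EquippedGroup.ambiguityIndex O) → EquippedGroup.FactSemigroup O,
        (∃ i, i.val = 0 ∧ s i = s₁) ∧
        (∀ i, s i ∈ EquippedGroup.withFactorSubgroup O ⊤) ∧
        (∀ i j, i < j → s i ≠ s j) ∧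
        (∀ i, EquippedGroup.type O (s i) = EquippedGroup.type O s₁) ∧
        (∀ i, EquippedGroup.prodHom O (s i) = EquippedGroup.prodHom O s₁) ∧
        (∀ t ∈ EquippedGroup.withFactorSubgroup O ⊤,
          EquippedGroup.type O t = EquippedGroup.type O s₁ →
          EquippedGroup.prodHom O t = EquippedGroup.prodHom O s₁ → ∃ i, t = s i) := by
  open EquippedGroup in
  obtain ⟨T₁, hT₁⟩ := exists_forall_eq_of_toCGroup_eq hO
  obtain ⟨T₂, hT₂⟩ := exists_forall_toCGroup_eq_mul hO
  refine ⟨max T₁ T₂, fun s₁ hs₁ hT => ?_⟩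
  have hinj (t) (ht : t ∈ withFactorSubgroup O ⊤) (u) (hu : u ∈ withFactorSubgroup O ⊤)
      (hts : type O t = type O s₁) (hus : type O u = type O s₁)
      (h : toCGroup O t = toCGroup O u) : t = u :=
    hT₁ t ht u hu (fun i => hts ▸ (le_max_left _ _).trans (hT i)) (hts.trans hus.symm) h
  choose f hf hfφ using hT₂ s₁ hs₁ fun i => (le_max_right _ _).trans (hT i)
  have hfτ (k) : type O (f k) = type O s₁ := type_eq_of_toCGroup_mul k.2.2 (hfφ k)
  have := finite_ker_beta_inf_commutator hO
  have hpos : 0 < ambiguityIndex O := Nat.card_pos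
  let e₀ : Fin (ambiguityIndex O) ≃ ↥((beta O).ker ⊓ commutator (cGraph O).CGroup) :=
    (Finite.equivFin _).symm
  -- The swap puts the trivial translate, which is s₁ itself, at index 0.
  let e := (Equiv.swap ⟨0, hpos⟩ (e₀.symm 1)).trans e₀
  refine ⟨fun i => f (e i), ⟨⟨0, hpos⟩, rfl, ?_⟩, fun i => hf _, fun i j hij h => ?_,
    fun i => hfτ _, fun i => ?_, fun t ht htτ htα => ?_⟩
  · refine hinj _ (hf _) _ hs₁ (hfτ _) rfl ?_
    rw [hfφ, show e ⟨0, hpos⟩ = 1 by simp [e]]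
    simp
  · have h1 := congrArg (toCGroup O) h
    rw [hfφ, hfφ, mul_left_inj] at h1
    exact hij.ne (e.injective (Subtype.ext h1))
  · rw [← beta_toCGroup, hfφ, map_mul, MonoidHom.mem_ker.1 (e i).2.1, one_mul, beta_toCGroup]
  -- The factors of s₁ already generate G, hence so does O.
  · have hG : Subgroup.closure O = ⊤ :=
      top_le_iff.1 (hs₁.symm.le.trans (factorSubgroup_le_closure O s₁))
    let k : ↥((beta O).ker ⊓ commutator (cGraph O).CGroup) :=
      ⟨toCGroup O t * (toCGroup O s₁)⁻¹, Subgroup.mem_inf.2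
        ⟨by simp [MonoidHom.mem_ker, beta_toCGroup, htα], by
          rw [← Abelianization.ker_of, MonoidHom.mem_ker, map_mul, map_inv,
            abelianization_toCGroup_eq hO hG htτ, mul_inv_cancel]⟩⟩
    refine ⟨e.symm k, hinj _ ht _ (hf _) htτ (hfτ _) ?_⟩
    simp [hfφ, k]
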